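/- Theorem. Consider the direct convolution of an input image of size $W_{in}\times H_{in}\times C_{in}$ with $C_{out}$ kernels of size $W_{ker}\times H_{ker}\times C_{in}$ and stride $\mu$, producing an output image of size $W_{out}\times H_{out}\times C_{out}$, without padding. All sizes are positive integers, $(W_{out}-1)\mu+W_{ker}\le W_{in}$, $(H_{out}-1)\mu+H_{ker}\le H_{in}$, and $1\le\mu\le\min(W_{ker},H_{ker})$. Let $R=W_{ker}H_{ker}/\mu^2$ (the reuse number of an input element). The computation graph (a DAG) of the direct convolution has as its inputs the entries of the image and of the kernels. For every output $(p,q,k)$ and every $(a,b,c)$ with $0\le a<W_{ker}$, $0\le b<H_{ker}$, $0\le c<C_{in}$ there is a product vertex whose predecessors are the image entry $(p\mu+a,\,q\mu+b,\,c)$ and the entry $(a,b,c)$ of the $k$-th kernel. For every output, the $W_{ker}H_{ker}C_{in}$ product vertices are the leaves of a summation tree, an arbitrary rooted tree in which every non-leaf vertex has exactly two predecessors (its children) and whose root is the output. The trees of different outputs are disjoint and may have different shapes. In the red-blue pebble game with at most $S$ red pebbles, exactly the inputs have blue pebbles at the start and there are no red pebbles; at the end every vertex without successors must have a blue pebble.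 The moves are: load (place a red pebble on a vertex with a blue pebble), store (place a blue pebble on a vertex with a red pebble), compute (place a red pebble on a non-input vertex all of whose predecessors have red pebbles), and free (remove a pebble). At most $S$ red pebbles are on the graph at any time, and recomputation is allowed. The number $Q$ of I/O operations is the number of loads and stores. Then the number of I/O operations satisfies $$Q=\Omega\left(\frac{W_{ker}H_{ker}C_{in}W_{out}H_{out}C_{out}}{4\sqrt{2RS}}\right),$$ that is, there is an absolute constant $\kappa>0$ such that for all such sizes and strides, all choices of the summation trees, all integers $S\ge1$, and every complete calculation of the red-blue pebble game on the computation graph with at most $S$ red pebbles, $$Q\ \ge\ \kappa\cdot\frac{W_{ker}H_{ker}C_{in}W_{out}H_{out}C_{out}}{4\sqrt{2RS}} .$$ -/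

import Mathlib

/-! ### The red-blue pebble game -/

/-- A configuration of pebbles: the vertices carrying a red pebble (fast memory) and the vertices
carrying a blue pebble (slow memory). -/
structure PebbleState (V : Type) where
  red : Set V
  blue : Set V

/-- The moves of the red-blue pebble game. -/
inductive PebbleMove (V : Type) where
  | load (v : V)
  | store (v : V)
  | compute (v : V)
  | freeRed (v : V)
  | freeBlue (v : V)

/-- An input of a directed graph is a vertex without predecessors. -/
def Digraph.IsInput {V : Type} (G : Digraph V) (v : V) : Prop := ∀ u, ¬ G.Adj u v

/-- An output of a directed graph is a vertex without successors. -/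
def Digraph.IsOutput {V : Type} (G : Digraph V) (v : V) : Prop := ∀ w, ¬ G.Adj v w

/-- When a move is allowed. Inputs are not computed: their data are initially in slow memory and
have to be loaded. -/
def PebbleMove.Legal {V : Type} (G : Digraph V) (s : PebbleState V) : PebbleMove V → Prop
  | .load v => v ∈ s.blue
  | .store v => v ∈ s.red
  | .compute v => ¬ G.IsInput v ∧ ∀ u, G.Adj u v → u ∈ s.red
  | .freeRed v => v ∈ s.red
  | .freeBlue v => v ∈ s.blue

/-- The effect of a move. -/
def PebbleMove.apply {V : Type} (s : PebbleState V) : PebbleMove V → PebbleState V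
  | .load v => ⟨insert v s.red, s.blue⟩
  | .store v => ⟨s.red, insert v s.blue⟩
  | .compute v => ⟨insert v s.red, s.blue⟩
  | .freeRed v => ⟨s.red \ {v}, s.blue⟩
  | .freeBlue v => ⟨s.red, s.blue \ {v}⟩

/-- Loads and stores are the I/O operations. -/
def PebbleMove.ioCost {V : Type} : PebbleMove V → ℕ
  | .load _ => 1
  | .store _ => 1
  | .compute _ => 0
  | .freeRed _ => 0
  | .freeBlue _ => 0

/-- A complete calculation of the red-blue pebble game on `G` with at most `S` red pebbles: at the
start exactly the inputs have blue pebbles and there are no red pebbles, at the end every output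
has a blue pebble. -/
structure CompleteCalculation {V : Type} (G : Digraph V) (S : ℕ) where
  length : ℕ
  state : ℕ → PebbleState V
  move : ℕ → PebbleMove V
  red_start : (state 0).red = ∅
  blue_start : (state 0).blue = {v | G.IsInput v}
  legal : ∀ t < length, (move t).Legal G (state t)
  step : ∀ t < length, state (t + 1) = (move t).apply (state t)
  red_le : ∀ t ≤ length, (state t).red.encard ≤ S
  blue_end : ∀ v, G.IsOutput v → v ∈ (state length).blue

/-- The number of I/O operations of a complete calculation. -/
def CompleteCalculation.io {V : Type} {G : Digraph V} {S : ℕ}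
    (P : CompleteCalculation G S) : ℕ :=
  ∑ t ∈ Finset.range P.length, (P.move t).ioCost

/-! ### Summation trees -/

/-- A summation tree: leaves are labelled by the summands, and every other vertex adds the values
of its two children. -/
inductive SumTree (α : Type) where
  | leaf (a : α)
  | add (l r : SumTree α)

namespace SumTree

/-- The vertices of a summation tree. -/
inductive Vertex {α : Type} : SumTree α → Type where
  | root (t : SumTree α) : Vertex t
  | inLeft {l r : SumTree α} (v : Vertex l) : Vertex (.add l r)
  | inRight {l r : SumTree α} (v : Vertex r) : Vertex (.add l r)

/-- The edges of a summation tree, directed from the summands to the sum. -/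
inductive Adj {α : Type} : (t : SumTree α) → t.Vertex → t.Vertex → Prop where
  | leftRoot (l r : SumTree α) : Adj (.add l r) (.inLeft (.root l)) (.root (.add l r))
  | rightRoot (l r : SumTree α) : Adj (.add l r) (.inRight (.root r)) (.root (.add l r))
  | inLeft {l r : SumTree α} {u v : l.Vertex} (h : Adj l u v) :
      Adj (.add l r) (.inLeft u) (.inLeft v)
  | inRight {l r : SumTree α} {u v : r.Vertex} (h : Adj r u v) :
      Adj (.add l r) (.inRight u) (.inRight v)

/-- `IsLeaf t v a`: the vertex `v` of `t` is a leaf with label `a`. -/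
inductive IsLeaf {α : Type} : (t : SumTree α) → t.Vertex → α → Prop where
  | leaf (a : α) : IsLeaf (.leaf a) (.root (.leaf a)) a
  | inLeft {l r : SumTree α} {v : l.Vertex} {a : α} (h : IsLeaf l v a) :
      IsLeaf (.add l r) (.inLeft v) a
  | inRight {l r : SumTree α} {v : r.Vertex} {a : α} (h : IsLeaf r v a) :
      IsLeaf (.add l r) (.inRight v) a

/-- The tree sums each `a : α` exactly once. -/
def SumsAll {α : Type} (t : SumTree α) : Prop := ∀ a : α, ∃! v : t.Vertex, t.IsLeaf v a

/-- The height of a tree. -/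
def height {α : Type} : SumTree α → ℕ
  | .leaf _ => 0
  | .add l r => max l.height r.height + 1

/-- The height of a vertex. -/
def Vertex.height {α : Type} : {t : SumTree α} → t.Vertex → ℕ
  | _, .root t => t.height
  | _, .inLeft v => v.height
  | _, .inRight v => v.height

theorem Adj.height_lt {α : Type} {t : SumTree α} {u v : t.Vertex} (h : t.Adj u v) :
    u.height < v.height := by
  induction h with
  | leftRoot l r => simp [Vertex.height, SumTree.height]
  | rightRoot l r => simp [Vertex.height, SumTree.height]
  | inLeft _ ih => exact ih
  | inRight _ ih => exact ih

end SumTree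

/-! ### The computation graph of a direct convolution -/

/-- The sizes of the input image, of the kernels and of the output image, and the stride. -/
structure ConvShape where
  Win : ℕ
  Hin : ℕ
  Cin : ℕ
  Wker : ℕ
  Hker : ℕ
  Wout : ℕ
  Hout : ℕ
  Cout : ℕ
  stride : ℕ

namespace ConvShape

/-- The index set of the entries of one kernel (and of one sliding input tensor). -/
abbrev KerIdx (s : ConvShape) : Type := Fin s.Wker × Fin s.Hker × Fin s.Cin

/-- One summation tree for each output. -/
abbrev Trees (s : ConvShape) : Type :=
  Fin s.Wout → Fin s.Hout → Fin s.Cout → SumTree s.KerIdx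

/-- The vertices of the computation graph: the entries of the input image, the entries of the
kernels, and the vertices of the summation trees; the leaves of the trees are the products. -/
inductive Vertex (s : ConvShape) (T : s.Trees) : Type where
  | image (x : Fin s.Win) (y : Fin s.Hin) (c : Fin s.Cin)
  | weight (k : Fin s.Cout) (e : s.KerIdx)
  | sum (p : Fin s.Wout) (q : Fin s.Hout) (k : Fin s.Cout) (v : (T p q k).Vertex)

/-- The edges of the computation graph. The product with index `e = (a, b, c)` for the output
`(p, q, k)` multiplies the entry `(p * stride + a, q * stride + b, c)` of the image with the entry
`(a, b, c)` of the kernel `k`. -/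
inductive Adj (s : ConvShape) (T : s.Trees) : s.Vertex T → s.Vertex T → Prop where
  | image {p : Fin s.Wout} {q : Fin s.Hout} {k : Fin s.Cout} {v : (T p q k).Vertex}
      {a : Fin s.Wker} {b : Fin s.Hker} {c : Fin s.Cin} {x : Fin s.Win} {y : Fin s.Hin}
      (hv : (T p q k).IsLeaf v (a, b, c))
      (hx : (x : ℕ) = p * s.stride + a) (hy : (y : ℕ) = q * s.stride + b) :
      Adj s T (.image x y c) (.sum p q k v)
  | weight {p : Fin s.Wout} {q : Fin s.Hout} {k : Fin s.Cout} {v : (T p q k).Vertex}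
      {e : s.KerIdx} (hv : (T p q k).IsLeaf v e) :
      Adj s T (.weight k e) (.sum p q k v)
  | tree {p : Fin s.Wout} {q : Fin s.Hout} {k : Fin s.Cout} {u v : (T p q k).Vertex}
      (h : (T p q k).Adj u v) :
      Adj s T (.sum p q k u) (.sum p q k v)

/-- The computation graph of the direct convolution. -/
def graph (s : ConvShape) (T : s.Trees) : Digraph (s.Vertex T) := ⟨s.Adj T⟩

/-- A vertex has larger rank than its predecessors. -/
def Vertex.rank {s : ConvShape} {T : s.Trees} : s.Vertex T → ℕ
  | .image _ _ _ => 0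
  | .weight _ _ => 0
  | .sum _ _ _ v => v.height + 1

/-- The computation graph has no directed cycles. -/
theorem graph_acyclic (s : ConvShape) (T : s.Trees) (v : s.Vertex T) :
    ¬ Relation.TransGen (s.graph T).Adj v v := by
  have step : ∀ u w, (s.graph T).Adj u w → u.rank < w.rank := by
    intro u w h
    cases h with
    | image => simp [Vertex.rank]
    | weight => simp [Vertex.rank]
    | tree h => simpa [Vertex.rank] using h.height_lt
  have main : ∀ u w, Relation.TransGen (s.graph T).Adj u w → u.rank < w.rank := by
    intro u w h
    induction h with
    | single h => exact step _ _ h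
    | tail _ h ih => exact ih.trans (step _ _ h)
  exact fun h => lt_irrefl _ (main _ _ h)

/-- The reuse number `R` of an input entry. -/
noncomputable def reuse (s : ConvShape) : ℝ := (s.Wker * s.Hker : ℝ) / (s.stride : ℝ) ^ 2

end ConvShape

/-! ### A discrete Loomis–Whitney inequality -/

/-! Recomputation is tamed by assigning to each product one time `τ`: the last moment when no
pebble, red or blue, lies on its vertex or on anything reachable from it. The move made then must
compute the product itself, so its image entry and its weight are red, and from then on its
summation tree always carries a pebble (`exists_lasting_compute`).

Consider the products assigned to an interval with `m` I/O operations and at most `r` red pebbles at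
its start. Their image entries and weights are red at the start or loaded, so at most `r + m`
vertices serve as operands. Their outputs own pairwise distinct vertices that are red at the end or
were stored, so at most `S + m` outputs occur. A product is pinned down by image entry, weight and
output, up to the overlap of the sliding windows, which costs a factor of at most `4R`
(`window_mul_le_reuse`). A Loomis–Whitney inequality then gives `|E|² ≤ 4R (r + m)² (S + m)`
(`card_products_sq_le`). With `m = r = S`, each phase of `S` operations accounts for `O(S √(RS))`
products, and summing over the phases gives the bound. -/

/-- Pairs `(x, y)` in a common fibre of `h` inject into `A × B` by `(f x, g y)`, so the squared
fibre sizes sum to at most `|A| |B|`; Cauchy–Schwarz over the fibres finishes. In `inj` the two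
pairs may lie over different values of `h`, since all fibres are counted at once. -/
theorem Finset.card_sq_le_of_projections {ι α β γ : Type*} (E : Finset ι)
    (f : ι → α) (g : ι → β) (h : ι → γ) (A : Finset α) (B : Finset β) (C : Finset γ)
    (hA : ∀ e ∈ E, f e ∈ A) (hB : ∀ e ∈ E, g e ∈ B) (hC : ∀ e ∈ E, h e ∈ C)
    (inj : ∀ e e' d d', h e = h e' → h d = h d' → f e = f d → g e' = g d' → e = d ∧ e' = d') :
    E.card ^ 2 ≤ A.card * B.card * C.card := by
  classical
  have h1 : E.card = ∑ c ∈ C, (E.filter (fun e => h e = c)).card :=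
    Finset.card_eq_sum_card_fiberwise hC
  have h2 : ∑ c ∈ C, (E.filter (fun e => h e = c)).card ^ 2 ≤ A.card * B.card := by
    have h3 : ∀ c, (E.filter (fun e => h e = c)).card ^ 2
        = (((E ×ˢ E).filter (fun x => h x.1 = h x.2)).filter (fun x => h x.1 = c)).card := by
      intro c
      rw [sq, ← Finset.card_product]
      congr 1
      ext ⟨x, y⟩
      simp only [Finset.mem_product, Finset.mem_filter]
      grind
    rw [Finset.sum_congr rfl (fun c _ => h3 c),
      ← Finset.card_eq_sum_card_fiberwise (f := fun x : ι × ι => h x.1),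
      ← Finset.card_product]
    · refine Finset.card_le_card_of_injOn (fun x => (f x.1, g x.2)) ?_ ?_
      · rintro ⟨x, y⟩ hx
        simp only [Finset.coe_filter, Finset.mem_product, Set.mem_ofPred_eq] at hx
        simpa using ⟨hA _ hx.1.1, hB _ hx.1.2⟩
      · rintro ⟨x, y⟩ hx ⟨z, w⟩ hz hxz
        simp only [Finset.coe_filter, Finset.mem_product, Set.mem_ofPred_eq] at hx hz
        simp only [Prod.mk.injEq] at hxz
        have := inj x y z w hx.2 hz.2 hxz.1 hxz.2
        simp [this.1, this.2]
    · rintro ⟨x, y⟩ hx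
      simp only [Finset.coe_filter, Finset.mem_product, Set.mem_ofPred_eq] at hx
      exact hC _ hx.1.1
  calc E.card ^ 2 = (∑ c ∈ C, (E.filter (fun e => h e = c)).card) ^ 2 := by rw [← h1]
    _ ≤ C.card * ∑ c ∈ C, (E.filter (fun e => h e = c)).card ^ 2 := sq_sum_le_card_mul_sum_sq
    _ ≤ C.card * (A.card * B.card) := Nat.mul_le_mul_left _ h2
    _ = A.card * B.card * C.card := by ring

/-! ### Pebbles during an interval of time -/

/-- The vertex on which a move acts. -/
def PebbleMove.target {V : Type} : PebbleMove V → V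
  | .load v => v
  | .store v => v
  | .compute v => v
  | .freeRed v => v
  | .freeBlue v => v

namespace CompleteCalculation

variable {V : Type} {G : Digraph V} {S : ℕ} (P : CompleteCalculation G S)

/-- The number of I/O operations before time `t`. -/
def ioBefore (t : ℕ) : ℕ := ∑ i ∈ Finset.range t, (P.move i).ioCost

theorem ioBefore_mono : Monotone P.ioBefore := fun _ _ h =>
  Finset.sum_le_sum_of_subset (Finset.range_subset_range.2 h)

/-- The vertices loaded or stored during the interval of time `[t₀, t₁)`. -/
def ioVertices (t₀ t₁ : ℕ) : Set V :=
  {v | ∃ t, t₀ ≤ t ∧ t < t₁ ∧ (P.move t = .load v ∨ P.move t = .store v)}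

/-- Each I/O operation acts on one vertex, so the targets of the I/O moves suffice. -/
theorem exists_finset_ioVertices {t₀ t₁ : ℕ} (h : t₀ ≤ t₁) :
    ∃ F : Finset V, P.ioVertices t₀ t₁ ⊆ F ∧ F.card + P.ioBefore t₀ ≤ P.ioBefore t₁ := by
  classical
  refine ⟨((Finset.Ico t₀ t₁).filter (fun t => (P.move t).ioCost = 1)).image
    (fun t => (P.move t).target), ?_, ?_⟩
  · rintro v ⟨t, h0, h1, hv⟩
    simp only [Finset.coe_image, Finset.coe_filter, Finset.mem_Ico, Set.mem_image,
      Set.mem_ofPred_eq]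
    refine ⟨t, ⟨⟨h0, h1⟩, ?_⟩, ?_⟩ <;> rcases hv with hv | hv <;> rw [hv] <;> rfl
  · have h1 : P.ioBefore t₀ + ∑ i ∈ Finset.Ico t₀ t₁, (P.move i).ioCost = P.ioBefore t₁ :=
      Finset.sum_range_add_sum_Ico _ h
    have h2 : ((Finset.Ico t₀ t₁).filter (fun t => (P.move t).ioCost = 1)).card
        ≤ ∑ i ∈ Finset.Ico t₀ t₁, (P.move i).ioCost := by
      rw [Finset.card_filter]
      refine Finset.sum_le_sum fun i _ => ?_
      split_ifs with hi <;> omega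
    have h3 := Finset.card_image_le (s := (Finset.Ico t₀ t₁).filter
      (fun t => (P.move t).ioCost = 1)) (f := fun t => (P.move t).target)
    omega

theorem red_finset {t : ℕ} (ht : t ≤ P.length) :
    ∃ F : Finset V, (P.state t).red = F ∧ F.card ≤ S := by
  have h := P.red_le t ht
  have hfin : (P.state t).red.Finite := Set.finite_of_encard_le_coe h
  refine ⟨hfin.toFinset, by simp, ?_⟩
  rw [hfin.encard_eq_coe_toFinset_card] at h
  exact_mod_cast h

/-- A red pebble on an input goes back to the start of the interval or to a load. -/
theorem red_input {v : V} (hv : G.IsInput v) {t₀ t : ℕ} (h : t₀ ≤ t) (ht : t ≤ P.length)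
    (hr : v ∈ (P.state t).red) : v ∈ (P.state t₀).red ∨ v ∈ P.ioVertices t₀ t := by
  induction t, h using Nat.le_induction with
  | base => exact Or.inl hr
  | succ t h ih =>
    have ih' : v ∈ (P.state t).red →
        v ∈ (P.state t₀).red ∨ v ∈ P.ioVertices t₀ (t + 1) := fun hh =>
      (ih (by omega) hh).imp id fun ⟨i, h1, h2, h3⟩ => ⟨i, h1, by omega, h3⟩
    have hl := P.legal t (by omega)
    rw [P.step t (by omega)] at hr
    cases hm : P.move t with
    | load u =>
      rw [hm] at hr
      rcases hr with rfl | hr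
      · exact Or.inr ⟨t, h, by omega, Or.inl hm⟩
      · exact ih' hr
    | store u => rw [hm] at hr; exact ih' hr
    | compute u =>
      rw [hm] at hr hl
      rcases hr with rfl | hr
      · exact absurd hv hl.1
      · exact ih' hr
    | freeRed u => rw [hm] at hr; exact ih' hr.1
    | freeBlue u => rw [hm] at hr; exact ih' hr

/-- A blue pebble goes back to the start of the interval or to a store. -/
theorem blue_vertex {v : V} {t₀ t : ℕ} (h : t₀ ≤ t) (ht : t ≤ P.length)
    (hr : v ∈ (P.state t).blue) : v ∈ (P.state t₀).blue ∨ v ∈ P.ioVertices t₀ t := by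
  induction t, h using Nat.le_induction with
  | base => exact Or.inl hr
  | succ t h ih =>
    have ih' : v ∈ (P.state t).blue →
        v ∈ (P.state t₀).blue ∨ v ∈ P.ioVertices t₀ (t + 1) := fun hh =>
      (ih (by omega) hh).imp id fun ⟨i, h1, h2, h3⟩ => ⟨i, h1, by omega, h3⟩
    rw [P.step t (by omega)] at hr
    cases hm : P.move t with
    | load u => rw [hm] at hr; exact ih' hr
    | store u =>
      rw [hm] at hr
      rcases hr with rfl | hr
      · exact Or.inr ⟨t, h, by omega, Or.inr hm⟩
      · exact ih' hr
    | compute u => rw [hm] at hr; exact ih' hr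
    | freeRed u => rw [hm] at hr; exact ih' hr
    | freeBlue u => rw [hm] at hr; exact ih' hr.1

/-- If `l` is not an input and an output is reachable from `l`, then at some time `l` is computed
such that from then on there is always a pebble on a vertex reachable from `l`; the blue ones among
these pebbles come from later stores. -/
theorem exists_lasting_compute {l o : V} (hl : ¬ G.IsInput l)
    (hlo : Relation.ReflTransGen G.Adj l o) (ho : G.IsOutput o) :
    ∃ τ < P.length, P.move τ = .compute l ∧ ∀ t, τ < t → t ≤ P.length →
      ∃ u, Relation.ReflTransGen G.Adj l u ∧
        (u ∈ (P.state t).red ∨ u ∈ P.ioVertices τ t) := by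
  classical
  -- `τ` below is the last time at which nothing reachable from `l`, including `l`, has a pebble.
  let free : ℕ → Prop := fun t => ∀ u, Relation.ReflTransGen G.Adj l u →
    u ∉ (P.state t).red ∧ u ∉ (P.state t).blue
  have hpred : ∀ u, Relation.ReflTransGen G.Adj l u →
      u = l ∨ ∃ w, Relation.ReflTransGen G.Adj l w ∧ G.Adj w u := fun u hu => by
    rcases Relation.ReflTransGen.cases_tail hu with h | ⟨w, h1, h2⟩
    · exact Or.inl h
    · exact Or.inr ⟨w, h1, h2⟩
  have hstart : free 0 := by
    intro u hu
    rw [P.red_start, P.blue_start]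
    refine ⟨by simp, fun hi => ?_⟩
    rcases hpred u hu with rfl | ⟨w, _, hw⟩
    · exact hl hi
    · exact hi w hw
  have hend : ¬ free P.length := fun h => (h o hlo).2 (P.blue_end o ho)
  let τ := Nat.findGreatest free P.length
  have hτ : free τ := Nat.findGreatest_spec (Nat.zero_le _) hstart
  have hlast : ∀ t, τ < t → t ≤ P.length → ¬ free t := fun t h1 h2 =>
    Nat.findGreatest_is_greatest h1 h2
  have hlt : τ < P.length := lt_of_le_of_ne (Nat.findGreatest_le _) fun h => hend (h ▸ hτ)
  refine ⟨τ, hlt, ?_, fun t h1 h2 => ?_⟩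
  -- Only computing `l` can end this state: a load or store needs a pebble already on the vertex,
  -- and computing any other reachable vertex needs a red predecessor that is itself reachable from
  -- `l`.
  · have hn := hlast (τ + 1) (by omega) hlt
    have hleg := P.legal τ hlt
    simp only [free, P.step τ hlt] at hn
    cases hm : P.move τ with
    | load v =>
      rw [hm] at hn hleg
      refine absurd (fun u hu => ⟨?_, (hτ u hu).2⟩) hn
      rintro (rfl | h)
      · exact (hτ _ hu).2 hleg
      · exact (hτ _ hu).1 h
    | store v =>
      rw [hm] at hn hleg
      refine absurd (fun u hu => ⟨(hτ u hu).1, ?_⟩) hn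
      rintro (rfl | h)
      · exact (hτ _ hu).1 hleg
      · exact (hτ _ hu).2 h
    | compute v =>
      rw [hm] at hn hleg
      by_contra hne
      refine hn fun u hu => ⟨?_, (hτ u hu).2⟩
      rintro (rfl | h)
      · rcases hpred u hu with rfl | ⟨w, hw1, hw2⟩
        · exact hne rfl
        · exact (hτ w hw1).1 (hleg.2 w hw2)
      · exact (hτ _ hu).1 h
    | freeRed v =>
      rw [hm] at hn
      exact absurd (fun u hu => ⟨fun h => (hτ u hu).1 h.1, (hτ u hu).2⟩) hn
    | freeBlue v =>
      rw [hm] at hn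
      exact absurd (fun u hu => ⟨(hτ u hu).1, fun h => (hτ u hu).2 h.1⟩) hn
  · have hn := hlast t h1 h2
    simp only [free, not_forall] at hn
    obtain ⟨u, hu, hn⟩ := hn
    refine ⟨u, hu, ?_⟩
    by_cases hr : u ∈ (P.state t).red
    · exact Or.inl hr
    · have hb : u ∈ (P.state t).blue := by
        by_contra hb
        exact hn ⟨hr, hb⟩
      exact (P.blue_vertex h1.le h2 hb).imp (fun h => absurd h (hτ u hu).2) id

end CompleteCalculation

/-! ### Paths in the computation graph -/

theorem SumTree.reflTransGen_root {α : Type} {t : SumTree α} (v : t.Vertex) :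
    Relation.ReflTransGen t.Adj v (.root t) := by
  induction v with
  | root t => exact .refl
  | @inLeft l r v ih =>
    exact (ih.lift (p := (SumTree.add l r).Adj) (fun u => .inLeft u) fun _ _ h => .inLeft h).tail
      (.leftRoot l r)
  | @inRight l r v ih =>
    exact (ih.lift (p := (SumTree.add l r).Adj) (fun u => .inRight u) fun _ _ h => .inRight h).tail
      (.rightRoot l r)

theorem SumTree.not_adj_root {α : Type} (t : SumTree α) (v : t.Vertex) :
    ¬ t.Adj (.root t) v := by
  intro h
  cases h

/-! ### Counting the products of the convolution in an interval of time -/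

namespace ConvShape

/-- The index set of the products. -/
abbrev ProdIdx (s : ConvShape) : Type :=
  (Fin s.Wout × Fin s.Hout × Fin s.Cout) × s.KerIdx

/-- The output to which a vertex of a summation tree belongs. -/
def Vertex.output {s : ConvShape} {T : s.Trees} :
    s.Vertex T → Option (Fin s.Wout × Fin s.Hout × Fin s.Cout)
  | .image _ _ _ => none
  | .weight _ _ => none
  | .sum p q k _ => some (p, q, k)

variable {s : ConvShape} {T : s.Trees}

theorem isInput_image (x : Fin s.Win) (y : Fin s.Hin) (c : Fin s.Cin) :
    (s.graph T).IsInput (.image x y c) := by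
  intro u h
  cases h

theorem isInput_weight (k : Fin s.Cout) (e : s.KerIdx) :
    (s.graph T).IsInput (.weight k e) := by
  intro u h
  cases h

theorem isOutput_root (p : Fin s.Wout) (q : Fin s.Hout) (k : Fin s.Cout) :
    (s.graph T).IsOutput (.sum p q k (.root (T p q k))) := by
  intro w h
  cases h with
  | tree h => exact SumTree.not_adj_root _ _ h

theorem output_eq_of_reflTransGen {p : Fin s.Wout} {q : Fin s.Hout} {k : Fin s.Cout}
    {v : (T p q k).Vertex} {u : s.Vertex T}
    (h : Relation.ReflTransGen (s.graph T).Adj (.sum p q k v) u) :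
    u.output = some (p, q, k) := by
  induction h with
  | refl => rfl
  | tail _ h ih =>
    cases h with
    | image => cases ih
    | weight => cases ih
    | tree h => exact ih

theorem output_index_lt {n μ w N : ℕ} (h : (n - 1) * μ + w ≤ N) (p : Fin n) (a : Fin w) :
    p * μ + a < N := by
  have h1 : (p : ℕ) * μ ≤ (n - 1) * μ := Nat.mul_le_mul_right _ (by omega)
  omega

/-- Every product has a computation after which there is always a pebble on the part of the
summation tree above it. -/
theorem exists_product_time {S : ℕ} (P : CompleteCalculation (s.graph T) S)
    (hW : (s.Wout - 1) * s.stride + s.Wker ≤ s.Win)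
    (hH : (s.Hout - 1) * s.stride + s.Hker ≤ s.Hin)
    (hT : ∀ p q k, (T p q k).SumsAll) (e : s.ProdIdx) :
    ∃ τ < P.length,
      P.ioBefore (τ + 1) = P.ioBefore τ ∧
      .image ⟨_, output_index_lt hW e.1.1 e.2.1⟩ ⟨_, output_index_lt hH e.1.2.1 e.2.2.1⟩ e.2.2.2
        ∈ (P.state τ).red ∧
      .weight e.1.2.2 e.2 ∈ (P.state τ).red ∧
      ∀ t, τ < t → t ≤ P.length → ∃ u : s.Vertex T, u.output = some e.1 ∧
        (u ∈ (P.state t).red ∨ u ∈ P.ioVertices τ t) := by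
  obtain ⟨⟨p, q, k⟩, a, b, c⟩ := e
  obtain ⟨v, hv, -⟩ := hT p q k (a, b, c)
  have hw : (s.graph T).Adj (.weight k (a, b, c)) (.sum p q k v) := Adj.weight hv
  have hi : (s.graph T).Adj
      (.image ⟨_, output_index_lt hW p a⟩ ⟨_, output_index_lt hH q b⟩ c) (.sum p q k v) :=
    Adj.image hv rfl rfl
  have hpath : Relation.ReflTransGen (s.graph T).Adj (.sum p q k v)
      (.sum p q k (.root (T p q k))) :=
    (SumTree.reflTransGen_root v).lift (p := (s.graph T).Adj) (fun u => .sum p q k u)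
      fun _ _ h => Adj.tree h
  obtain ⟨τ, hlt, hm, hlast⟩ :=
    P.exists_lasting_compute (fun h => h _ hw) hpath (isOutput_root p q k)
  have hleg := P.legal τ hlt
  rw [hm] at hleg
  refine ⟨τ, hlt, ?_, hleg.2 _ hi, hleg.2 _ hw, fun t h1 h2 => ?_⟩
  · rw [CompleteCalculation.ioBefore, Finset.sum_range_succ, hm]
    rfl
  · obtain ⟨u, hu, hu'⟩ := hlast t h1 h2
    exact ⟨u, output_eq_of_reflTransGen hu, hu'⟩

/-- The number of products computed lastingly during an interval of time with `m` I/O operations,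
if there are at most `r` red pebbles at its start. -/
theorem card_products_sq_le {S : ℕ} (P : CompleteCalculation (s.graph T) S)
    (hμ : 0 < s.stride)
    (hW : (s.Wout - 1) * s.stride + s.Wker ≤ s.Win)
    (hH : (s.Hout - 1) * s.stride + s.Hker ≤ s.Hin)
    (τ : s.ProdIdx → ℕ)
    (hi : ∀ e, .image ⟨_, output_index_lt hW e.1.1 e.2.1⟩ ⟨_, output_index_lt hH e.1.2.1 e.2.2.1⟩
      e.2.2.2 ∈ (P.state (τ e)).red)
    (hw : ∀ e, .weight e.1.2.2 e.2 ∈ (P.state (τ e)).red)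
    (hlast : ∀ e t, τ e < t → t ≤ P.length → ∃ u : s.Vertex T, u.output = some e.1 ∧
        (u ∈ (P.state t).red ∨ u ∈ P.ioVertices (τ e) t))
    (E : Finset s.ProdIdx) {t₀ t₁ m r : ℕ} (h01 : t₀ ≤ t₁) (h1 : t₁ ≤ P.length)
    (hE : ∀ e ∈ E, t₀ ≤ τ e ∧ τ e < t₁)
    (hm : P.ioBefore t₁ ≤ P.ioBefore t₀ + m) (hr : (P.state t₀).red.encard ≤ r) :
    E.card ^ 2 ≤
      ((s.Wker / s.stride + 1) * (s.Hker / s.stride + 1)) * (r + m) ^ 2 * (S + m) := by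
  classical
  obtain ⟨I, hI, hIc⟩ := P.exists_finset_ioVertices h01
  obtain ⟨F₁, hF₁, hF₁c⟩ := P.red_finset h1
  have hfin : (P.state t₀).red.Finite := Set.finite_of_encard_le_coe hr
  obtain ⟨F₀, hF₀, hF₀c⟩ : ∃ F : Finset (s.Vertex T), (P.state t₀).red = F ∧ F.card ≤ r := by
    refine ⟨hfin.toFinset, by simp, ?_⟩
    rw [hfin.encard_eq_coe_toFinset_card] at hr
    exact_mod_cast hr
  have hinput : ∀ e ∈ E, ∀ v, (s.graph T).IsInput v → v ∈ (P.state (τ e)).red → v ∈ F₀ ∪ I := by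
    intro e he v hv hred
    rcases P.red_input hv (hE e he).1 ((hE e he).2.le.trans h1) hred with h | ⟨i, h2, h3, h4⟩
    · rw [hF₀] at h
      exact Finset.mem_union_left _ h
    · exact Finset.mem_union_right _ (hI ⟨i, h2, h3.trans (hE e he).2, h4⟩)
  -- The quotients of the window offsets by the stride are added to the image entry: together they
  -- recover everything but the kernel number, which the weight supplies; the common output then
  -- completes both products.
  have key := Finset.card_sq_le_of_projections E
    (fun e => ((.image ⟨_, output_index_lt hW e.1.1 e.2.1⟩
      ⟨_, output_index_lt hH e.1.2.1 e.2.2.1⟩ e.2.2.2 : s.Vertex T),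
      (e.2.1 : ℕ) / s.stride, (e.2.2.1 : ℕ) / s.stride))
    (fun e => (.weight e.1.2.2 e.2 : s.Vertex T))
    (fun e => some e.1)
    ((F₀ ∪ I) ×ˢ Finset.range (s.Wker / s.stride + 1) ×ˢ Finset.range (s.Hker / s.stride + 1))
    (F₀ ∪ I) ((F₁ ∪ I).image Vertex.output)
    (fun e he => by
      simp only [Finset.mem_product, Finset.mem_range]
      exact ⟨hinput e he _ (isInput_image _ _ _) (hi e),
        Nat.lt_succ_of_le (Nat.div_le_div_right e.2.1.2.le),
        Nat.lt_succ_of_le (Nat.div_le_div_right e.2.2.1.2.le)⟩)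
    (fun e he => hinput e he _ (isInput_weight _ _) (hw e))
    -- Each output is charged to a vertex of its own tree that is red at `t₁` or was stored or
    -- loaded in the interval.
    (fun e he => by
      obtain ⟨u, hu, hu'⟩ := hlast e t₁ (hE e he).2 h1
      refine Finset.mem_image.2 ⟨u, ?_, hu⟩
      rcases hu' with h | ⟨i, h2, h3, h4⟩
      · rw [hF₁] at h
        exact Finset.mem_union_left _ h
      · exact Finset.mem_union_right _ (hI ⟨i, (hE e he).1.trans h2, h3, h4⟩))
    (by
      -- The coordinate fixes `a` modulo the stride and the quotient fixes the rest.
      have aux : ∀ {p a p' a' : ℕ}, p * s.stride + a = p' * s.stride + a' →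
          a / s.stride = a' / s.stride → p = p' ∧ a = a' := by
        intro p a p' a' h1 h2
        have h3 : a = a' := by
          have h4 : a % s.stride = a' % s.stride := by
            simpa [Nat.mul_add_mod'] using congrArg (· % s.stride) h1
          rw [← Nat.div_add_mod a s.stride, ← Nat.div_add_mod a' s.stride, h2, h4]
        subst h3
        exact ⟨Nat.eq_of_mul_eq_mul_right hμ (by omega), rfl⟩
      rintro ⟨⟨p, q, k⟩, a, b, c⟩ ⟨⟨p', q', k'⟩, a', b', c'⟩ ⟨⟨p₁, q₁, k₁⟩, a₁, b₁, c₁⟩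
        ⟨⟨p₂, q₂, k₂⟩, a₂, b₂, c₂⟩ h1 h2 h3 h4
      simp only [Option.some.injEq, Prod.mk.injEq, Vertex.image.injEq, Vertex.weight.injEq,
        Fin.mk.injEq] at h1 h2 h3 h4 ⊢
      obtain ⟨rfl, rfl, rfl⟩ := h1
      obtain ⟨rfl, rfl, rfl⟩ := h2
      obtain ⟨rfl, rfl, rfl, rfl⟩ := h4
      obtain ⟨⟨hx, hy, rfl⟩, hx', hy'⟩ := h3
      obtain ⟨h5, h6⟩ := aux hx hx'
      obtain ⟨h7, h8⟩ := aux hy hy'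
      simp [Fin.ext_iff, h5, h6, h7, h8])
  have hU : (F₀ ∪ I).card ≤ r + m := (Finset.card_union_le _ _).trans (by omega)
  have hV : ((F₁ ∪ I).image Vertex.output).card ≤ S + m :=
    Finset.card_image_le.trans ((Finset.card_union_le _ _).trans (by omega))
  simp only [Finset.card_product, Finset.card_range] at key
  calc E.card ^ 2 ≤ _ := key
    _ ≤ (r + m) * ((s.Wker / s.stride + 1) * (s.Hker / s.stride + 1)) * (r + m) * (S + m) := by
      gcongr
    _ = _ := by ring

/-- As the stride is at most the kernel side, the `+ 1` that accounts for rounding at most doubles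
each factor. -/
theorem window_mul_le_reuse (hμ : 0 < s.stride) (hW : s.stride ≤ s.Wker)
    (hH : s.stride ≤ s.Hker) :
    (((s.Wker / s.stride + 1) * (s.Hker / s.stride + 1) : ℕ) : ℝ) ≤ 4 * s.reuse := by
  have hμ' : (0 : ℝ) < s.stride := by exact_mod_cast hμ
  have aux : ∀ w : ℕ, s.stride ≤ w → ((w / s.stride + 1 : ℕ) : ℝ) ≤ 2 * (w / s.stride : ℝ) := by
    intro w hw
    have h1 : ((w / s.stride : ℕ) : ℝ) ≤ (w / s.stride : ℝ) := Nat.cast_div_le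
    have h2 : (1 : ℝ) ≤ (w / s.stride : ℝ) := by
      rw [one_le_div hμ']
      exact_mod_cast hw
    push_cast
    linarith
  calc (((s.Wker / s.stride + 1) * (s.Hker / s.stride + 1) : ℕ) : ℝ)
      = ((s.Wker / s.stride + 1 : ℕ) : ℝ) * ((s.Hker / s.stride + 1 : ℕ) : ℝ) := by
        rw [Nat.cast_mul]
    _ ≤ (2 * (s.Wker / s.stride : ℝ)) * (2 * (s.Hker / s.stride : ℝ)) :=
      mul_le_mul (aux _ hW) (aux _ hH) (by positivity) (by positivity)
    _ = 4 * s.reuse := by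
      rw [reuse]
      field_simp
      ring

end ConvShape

/-! ### The lower bound, by phases of `S` I/O operations -/

theorem mainTheorem3 :
    ∃ κ : ℝ, 0 < κ ∧
      ∀ s : ConvShape,
        0 < s.Cin → 0 < s.Wout → 0 < s.Hout → 0 < s.Cout →
        0 < s.stride → s.stride ≤ s.Wker → s.stride ≤ s.Hker →
        (s.Wout - 1) * s.stride + s.Wker ≤ s.Win →
        (s.Hout - 1) * s.stride + s.Hker ≤ s.Hin →
        ∀ T : s.Trees, (∀ p q k, (T p q k).SumsAll) →
        ∀ S : ℕ, 0 < S → ∀ P : CompleteCalculation (s.graph T) S,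
          κ * ((s.Wker * s.Hker * s.Cin * s.Wout * s.Hout * s.Cout : ℝ) /
            (4 * Real.sqrt (2 * s.reuse * S))) ≤ (P.io : ℝ) := by
  -- With `D = √(2RS)`, the argument yields at most `8 D Q` products, and `8 D = 4 D / (1 / 2)`.
  refine ⟨1 / 2, by norm_num, ?_⟩
  intro s _ _ _ _ hμ hμW hμH hW hH T hT S hS P
  choose τ hτ hio hi hw hlast using ConvShape.exists_product_time P hW hH hT
  have hwindow := ConvShape.card_products_sq_le P hμ hW hH τ hi hw hlast
  have hM := ConvShape.window_mul_le_reuse hμ hμW hμH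
  set M := (s.Wker / s.stride + 1) * (s.Hker / s.stride + 1)
  have hcard : (s.Wker * s.Hker * s.Cin * s.Wout * s.Hout * s.Cout : ℝ)
      = ((Finset.univ : Finset s.ProdIdx).card : ℝ) := by
    simp only [Finset.card_univ, Fintype.card_prod, Fintype.card_fin]
    push_cast
    ring
  have hM0 : (0 : ℝ) < M := by
    have : 0 < M := by positivity
    exact_mod_cast this
  have hS0 : (0 : ℝ) < S := by exact_mod_cast hS
  have hR0 : 0 < 2 * s.reuse * S := by
    have : 0 < s.reuse := by linarith
    positivity
  set D := Real.sqrt (2 * s.reuse * S)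
  have hD0 : 0 < D := Real.sqrt_pos.2 hR0
  have hD : D ^ 2 = 2 * s.reuse * S := Real.sq_sqrt hR0.le
  have hMS : (M : ℝ) * S ≤ 2 * D ^ 2 := by
    rw [hD]
    nlinarith
  rw [hcard]
  suffices h : ((Finset.univ : Finset s.ProdIdx).card : ℝ) ≤ 8 * D * P.io by
    rw [mul_div_assoc', div_le_iff₀ (by positivity)]
    linarith
  have hQ : P.io = P.ioBefore P.length := rfl
  -- With fewer than `S` operations the whole calculation is one interval. It starts without red
  -- pebbles, so `r = 0` and the bound is proportional to `Q` instead of `S`.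
  rcases lt_or_ge P.io S with hlt | hge
  · have h := hwindow Finset.univ (t₀ := 0) (t₁ := P.length) (m := P.io) (r := 0)
      (Nat.zero_le _) le_rfl (fun e _ => ⟨Nat.zero_le _, hτ e⟩) (by omega)
      (by simp [P.red_start])
    have h' : ((Finset.univ : Finset s.ProdIdx).card : ℝ) ^ 2
        ≤ M * (0 + P.io) ^ 2 * (S + P.io) := by exact_mod_cast h
    have hlt' : (P.io : ℝ) ≤ S := by exact_mod_cast hlt.le
    refine (pow_le_pow_iff_left₀ (by positivity) (by positivity) two_ne_zero).1 ?_
    calc ((Finset.univ : Finset s.ProdIdx).card : ℝ) ^ 2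
        ≤ M * (0 + P.io) ^ 2 * (S + P.io) := h'
      _ ≤ M * (0 + P.io) ^ 2 * (S + S) := by gcongr
      _ = 2 * (M * S) * (P.io : ℝ) ^ 2 := by ring
      _ ≤ 2 * (2 * D ^ 2) * (P.io : ℝ) ^ 2 := by gcongr
      _ ≤ (8 * D * P.io) ^ 2 := by nlinarith [sq_nonneg (D * P.io)]
  -- The products are grouped into phases by the number of I/O operations before `τ`, divided by
  -- `S`.
  · have hgroup : ∀ j ∈ Finset.range (P.io / S + 1),
        ((Finset.univ.filter (fun e => P.ioBefore (τ e) / S = j)).card : ℝ) ≤ 4 * D * S := by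
      intro j _
      set E := Finset.univ.filter (fun e => P.ioBefore (τ e) / S = j)
      rcases E.eq_empty_or_nonempty with h0 | hne
      · rw [h0]
        simp only [Finset.card_empty, Nat.cast_zero]
        positivity
      obtain ⟨e₀, he₀, hmin⟩ := E.exists_min_image τ hne
      obtain ⟨e₁, he₁, hmax⟩ := E.exists_max_image τ hne
      -- The move at `τ e₁` is a computation and costs nothing, so including it keeps the interval
      -- within `S` operations.
      have hle : P.ioBefore (τ e₁ + 1) ≤ P.ioBefore (τ e₀) + S := by
        rw [hio]
        have h0 : P.ioBefore (τ e₀) / S = j := (Finset.mem_filter.1 he₀).2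
        have h1 : P.ioBefore (τ e₁) / S = j := (Finset.mem_filter.1 he₁).2
        have h2 := Nat.div_add_mod (P.ioBefore (τ e₀)) S
        have h3 := Nat.div_add_mod (P.ioBefore (τ e₁)) S
        have h4 := Nat.mod_lt (P.ioBefore (τ e₁)) hS
        rw [h0] at h2
        rw [h1] at h3
        omega
      have h := hwindow E (t₀ := τ e₀) (t₁ := τ e₁ + 1) (m := S) (r := S)
        ((hmin e₁ he₁).trans (Nat.le_succ _)) (hτ e₁)
        (fun e he => ⟨hmin e he, Nat.lt_succ_of_le (hmax e he)⟩) hle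
        (P.red_le _ (hτ e₀).le)
      have h' : (E.card : ℝ) ^ 2 ≤ M * (S + S) ^ 2 * (S + S) := by exact_mod_cast h
      refine (pow_le_pow_iff_left₀ (by positivity) (by positivity) two_ne_zero).1 ?_
      calc (E.card : ℝ) ^ 2 ≤ M * (S + S) ^ 2 * (S + S) := h'
        _ = 8 * (M * S) * (S : ℝ) ^ 2 := by ring
        _ ≤ 8 * (2 * D ^ 2) * (S : ℝ) ^ 2 := by gcongr
        _ = (4 * D * S) ^ 2 := by ring
    have hsum : (Finset.univ : Finset s.ProdIdx).card = ∑ j ∈ Finset.range (P.io / S + 1),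
        (Finset.univ.filter (fun e => P.ioBefore (τ e) / S = j)).card := by
      refine Finset.card_eq_sum_card_fiberwise fun e _ => ?_
      simp only [Finset.coe_range, Set.mem_Iio]
      exact Nat.lt_succ_of_le (Nat.div_le_div_right (P.ioBefore_mono (hτ e).le))
    -- Here `S ≤ Q` absorbs the possibly incomplete last phase.
    have hcount : ((P.io / S + 1 : ℕ) : ℝ) * S ≤ 2 * P.io := by
      have h1 := Nat.div_mul_le_self P.io S
      have h2 : (P.io / S + 1) * S ≤ 2 * P.io := by
        rw [add_mul]
        omega
      exact_mod_cast h2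
    calc ((Finset.univ : Finset s.ProdIdx).card : ℝ)
        = ∑ j ∈ Finset.range (P.io / S + 1),
          ((Finset.univ.filter (fun e => P.ioBefore (τ e) / S = j)).card : ℝ) := by
          rw [hsum, Nat.cast_sum]
      _ ≤ ∑ _j ∈ Finset.range (P.io / S + 1), 4 * D * S := Finset.sum_le_sum hgroup
      _ = 4 * D * (((P.io / S + 1 : ℕ) : ℝ) * S) := by
          rw [Finset.sum_const, Finset.card_range, nsmul_eq_mul]
          ring
      _ ≤ 4 * D * (2 * P.io) := by gcongr
      _ = 8 * D * P.io := by ring
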